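/- For every $\varepsilon > 0$ there is a constant $C = C(\varepsilon)$, depending only on $\varepsilon$, such that for every integer $n \ge 0$ and every set $A \subset \mathbb{F}_2^n$ there is a subspace $V \leq \mathbb{F}_2^n$ of codimension at most $C$ such that $A$ is $\varepsilon$-uniform on $V$ itself, that is, \[ \Big| \frac{1}{|V|} \sum_{x \in A \cap V} (-1)^{r \cdot x} \Big| \leq \varepsilon \quad \text{for every } r \in \mathbb{F}_2^n \setminus V^{\perp}, \] where $r \cdot x$ is the dot product and $V^{\perp} = \{ r \in \mathbb{F}_2^n : r \cdot v = 0 \text{ for all } v \in V \}$. (The left-hand side is $|(1_A \mu_V)^{\wedge}(r)|$, where $\mu_V$ is the uniform probability measure on $V$.) -/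

import Mathlib

namespace FourierUniformity

/-- The orthogonal complement `V^⊥` of a subspace `V` of `𝔽_p^n` with respect to the dot product. -/
def perp {p n : ℕ} (V : Submodule (ZMod p) (Fin n → ZMod p)) : Set (Fin n → ZMod p) :=
  {r | ∀ v ∈ V, r ⬝ᵥ v = 0}

/-- The coset `x + V`. -/
def coset {p n : ℕ} (x : Fin n → ZMod p) (V : Submodule (ZMod p) (Fin n → ZMod p)) :
    Set (Fin n → ZMod p) :=
  (fun v => x + v) '' (V : Set (Fin n → ZMod p))

/-- The uniform probability measure `μ_S` on a non-empty finite set `S`, given by its point masses: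
`|S|⁻¹` at each `s ∈ S`, and `0` elsewhere. -/
noncomputable def unif {G : Type*} (S : Set G) : G → ℂ :=
  S.indicator fun _ => (Nat.card S : ℂ)⁻¹

/-- The Fourier transform at `r` of the complex measure on `𝔽_p^n` with point masses `ν x`, that is
the integral of `e_p(-r · x)` against it, where `e_p(t) = exp(2πit/p)`. -/
noncomputable def fourierCoeffAt {p n : ℕ} [NeZero p] (ν : (Fin n → ZMod p) → ℂ)
    (r : Fin n → ZMod p) : ℂ :=
  ∑ x, ν x * ZMod.stdAddChar (-(r ⬝ᵥ x))

/-- `A` is `ε`-uniform on the coset `x + V`: all Fourier coefficients of `1_A μ_{x + V}` at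
frequencies outside `V^⊥` have magnitude at most `ε`. -/
def IsUniformOn {p n : ℕ} [NeZero p] (ε : ℝ) (A : Set (Fin n → ZMod p))
    (x : Fin n → ZMod p) (V : Submodule (ZMod p) (Fin n → ZMod p)) : Prop :=
  ∀ r, r ∉ perp V → ‖fourierCoeffAt (fun y => A.indicator 1 y * unif (coset x V) y) r‖ ≤ ε

end FourierUniformity

/-! Regularity makes `A` uniform on most cosets of some `W` of bounded codimension, but `W` itself
may be exceptional. The remedy is to take `V = W ⊔ S`, averaging over many good cosets so that `W`
has weight only `1/|S|`. Since bad points are sparse, a subspace `U` of large dimension has no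
nonzero bad vector (`exists_uniform_cosets`). Colouring `u` by the rounded density of `A` on `u +
W`, a Ramsey theorem derived from Hales–Jewett (`exists_mono_subspace`) gives `S ≤ U` whose nonzero
vectors share one density up to a small error. A frequency outside `W^⊥` is then controlled by
uniformity on the cosets `s + W`; one in `W^⊥` but not in `S^⊥` sees only their densities, and
cancels because these are nearly equal (`abs_avg_sup_twist_le`). -/

namespace FourierUniformity

/-! ### Ramsey theory and greedy choice of subspaces over `𝔽₂`. -/

section Ramsey

open Module Submodule Finset

/-- A combinatorial subspace over a module is the image of an injective affine map. -/
theorem exists_linear_part {d N : ℕ} (l : Combinatorics.Subspace (Fin d) (ZMod 2) (Fin N)) :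
    ∃ M : (Fin d → ZMod 2) →ₗ[ZMod 2] (Fin N → ZMod 2),
      Function.Injective M ∧ ∀ t, l t = l 0 + M t := by
  refine ⟨LinearMap.pi fun i => (l.idxFun i).elim (fun _ => 0) fun e => LinearMap.proj e,
    fun s t h => ?_, fun t => ?_⟩
  · ext e
    obtain ⟨i, hi⟩ := l.proper e
    simpa [hi] using congrFun h i
  · ext i
    rcases h : l.idxFun i with a | e <;> simp [Combinatorics.Subspace.apply_def, h]

/-- In large dimension, every finite colouring is constant on a translate `x + T` of a subspace `T`
of prescribed dimension, with `x ∉ T`. -/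
theorem exists_mono_translate (K : Type) [Finite K] (d : ℕ) :
    ∃ D : ℕ, ∀ (n : ℕ) (U : Submodule (ZMod 2) (Fin n → ZMod 2)), D ≤ finrank (ZMod 2) U →
      ∀ c : (Fin n → ZMod 2) → K, ∃ x ∈ U, ∃ T ≤ U, x ∉ T ∧ finrank (ZMod 2) T = d ∧
        ∃ κ, ∀ t ∈ T, c (x + t) = κ := by
  obtain ⟨N, hN⟩ := Combinatorics.Subspace.exists_mono_in_high_dimension_fin (ZMod 2) K (Fin d)
  refine ⟨N + 1, fun n U hU c => ?_⟩
  obtain ⟨v, hv⟩ := exists_linearIndependent_of_le_finrank (R := ZMod 2) hU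
  set L : (Fin (N + 1) → ZMod 2) →ₗ[ZMod 2] (Fin n → ZMod 2) :=
    U.subtype ∘ₗ Fintype.linearCombination (ZMod 2) v with hL
  have hLinj : Function.Injective L :=
    U.injective_subtype.comp (hv.fintypeLinearCombination_injective)
  have hLU : ∀ z, L z ∈ U := fun z => (Fintype.linearCombination (ZMod 2) v z).2
  -- Freezing the first coordinate at 1 keeps `x` outside `T`, whose vectors have first coordinate
  -- 0.
  obtain ⟨l, κ, hl⟩ := hN fun z => c (L (Fin.cons 1 z))
  obtain ⟨M, hM, hlM⟩ := exists_linear_part l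
  let J : (Fin N → ZMod 2) →ₗ[ZMod 2] (Fin (N + 1) → ZMod 2) :=
    { toFun := fun z => Fin.cons 0 z
      map_add' := fun a b => by
        ext i; refine Fin.cases ?_ (fun j => ?_) i <;> simp
      map_smul' := fun a b => by
        ext i; refine Fin.cases ?_ (fun j => ?_) i <;> simp }
  have hJ : Function.Injective J := fun a b h => Fin.cons_right_injective (α := fun _ => ZMod 2) 0 h
  refine ⟨L (Fin.cons 1 (l 0)), hLU _, LinearMap.range (L ∘ₗ J ∘ₗ M), ?_, ?_, ?_, κ, ?_⟩
  · rintro _ ⟨t, rfl⟩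
    exact hLU _
  · rintro ⟨t, ht⟩
    have := congrFun (hLinj ht) 0
    simp [J] at this
  · have hinj : Function.Injective (L ∘ₗ J ∘ₗ M) := hLinj.comp (hJ.comp hM)
    rw [LinearMap.finrank_range_of_inj hinj]
    simp
  · rintro _ ⟨t, rfl⟩
    rw [← hl t]
    simp only [LinearMap.comp_apply, ← map_add]
    congr 2
    ext i
    refine Fin.cases ?_ (fun j => ?_) i <;> simp [J, hlM t]

theorem mem_sup_span_singleton {n : ℕ} {S : Submodule (ZMod 2) (Fin n → ZMod 2)}
    {x y : Fin n → ZMod 2} (h : y ∈ S ⊔ span (ZMod 2) {x}) : y ∈ S ∨ ∃ s ∈ S, y = x + s := by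
  obtain ⟨s, hs, z, hz, rfl⟩ := Submodule.mem_sup.1 h
  obtain ⟨a, rfl⟩ := Submodule.mem_span_singleton.1 hz
  have ha : ∀ b : ZMod 2, b = 0 ∨ b = 1 := by decide
  rcases ha a with rfl | rfl
  · left; simpa using hs
  · right; exact ⟨s, hs, by simp [add_comm]⟩

/-- Ramsey theorem for the nonzero vectors of a vector space over `𝔽₂`. -/
theorem exists_mono_subspace (K : Type) [Fintype K] [DecidableEq K] (m : K → ℕ) :
    ∃ D : ℕ, ∀ (n : ℕ) (U : Submodule (ZMod 2) (Fin n → ZMod 2)), D ≤ finrank (ZMod 2) U →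
      ∀ c : (Fin n → ZMod 2) → K, ∃ κ, ∃ S ≤ U, finrank (ZMod 2) S = m κ ∧
        ∀ s ∈ S, s ≠ 0 → c s = κ := by
  induction h : ∑ κ, m κ using Nat.strong_induction_on generalizing m with
  | _ N ih =>
  subst h
  by_cases h0 : ∃ κ, m κ = 0
  · obtain ⟨κ, hκ⟩ := h0
    exact ⟨0, fun n U _ c => ⟨κ, ⊥, bot_le, by simp [hκ], by simp⟩⟩
  push Not at h0
  have hlt : ∀ κ, ∑ i, Function.update m κ (m κ - 1) i < ∑ i, m i := fun κ => by
    refine sum_lt_sum (fun i _ => ?_) ⟨κ, mem_univ _, ?_⟩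
    · by_cases hi : i = κ
      · subst hi; simp
      · simp [hi]
    · have := h0 κ
      simp only [Function.update_self]
      omega
  choose D hD using fun κ => ih _ (hlt κ) _ rfl
  -- The colour `κ` of `x + T` is known only after `T`, so `T` must be large enough for every `D κ`.
  -- If `S ≤ T` again has colour `κ`, adjoining `x` adds only vectors of `x + T`.
  obtain ⟨D', hD'⟩ := exists_mono_translate K (∑ κ, D κ)
  refine ⟨D', fun n U hU c => ?_⟩
  obtain ⟨x, hxU, T, hTU, hxT, hT, κ, hκ⟩ := hD' n U hU c
  obtain ⟨κ', S, hST, hS, hc⟩ :=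
    hD κ n T (hT ▸ single_le_sum (f := D) (fun _ _ => Nat.zero_le _) (mem_univ κ)) c
  by_cases hκκ : κ' = κ
  · subst hκκ
    refine ⟨κ', S ⊔ span (ZMod 2) {x}, sup_le (hST.trans hTU) (by simpa using hxU), ?_, ?_⟩
    · rw [finrank_sup_span_singleton fun hx => hxT (hST hx), hS]
      have := h0 κ'
      simp only [Function.update_self]
      omega
    · intro s hs hs0
      rcases mem_sup_span_singleton hs with hs | ⟨t, ht, rfl⟩
      · exact hc s hs hs0
      · exact hκ t (hST ht)
  · exact ⟨κ', S, hST.trans hTU, by simpa [hκκ] using hS, hc⟩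

/-- A sparse set containing `0` is avoided by the nonzero vectors of some subspace. -/
theorem exists_subspace_avoiding {n D : ℕ} (B : Finset (Fin n → ZMod 2)) (h0 : 0 ∈ B)
    (hB : 2 ^ D * #B < 2 ^ n) :
    ∃ U : Submodule (ZMod 2) (Fin n → ZMod 2), finrank (ZMod 2) U = D ∧
      ∀ u ∈ U, u ≠ 0 → u ∉ B := by
  classical
  induction D with
  | zero => exact ⟨⊥, by simp, by simp⟩
  | succ D ih =>
  have hle : 2 ^ D * #B ≤ 2 ^ (D + 1) * #B := by gcongr <;> simp
  obtain ⟨U, hU, hUB⟩ := ih (hle.trans_lt hB)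
  -- A vector `x` outside `U + B` extends `U`: no `x + t` lies in `B`, and `0 ∈ B` forces `x ∉ U`.
  let P : Finset (Fin n → ZMod 2) := image₂ (fun u b => u + b) {u | u ∈ U} B
  have hUc : #({u | u ∈ U} : Finset (Fin n → ZMod 2)) = 2 ^ D := by
    rw [← hU, ← Fintype.card_subtype]
    simpa using Module.card_eq_pow_finrank (K := ZMod 2) (V := U)
  have hP : #P < #(univ : Finset (Fin n → ZMod 2)) := by
    refine (card_image₂_le _ _ _).trans_lt ?_
    rw [hUc]
    exact (hle.trans_lt hB).trans_eq (by simp)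
  obtain ⟨x, -, hx⟩ := exists_mem_notMem_of_card_lt_card hP
  have hxu : ∀ u ∈ U, ∀ b ∈ B, x ≠ u + b := fun u hu b hb h =>
    hx (mem_image₂.2 ⟨u, by simpa using hu, b, hb, h.symm⟩)
  refine ⟨U ⊔ span (ZMod 2) {x}, ?_, ?_⟩
  · rw [finrank_sup_span_singleton fun hxU => hxu x hxU 0 h0 (by simp), hU]
  · intro u hu hu0
    rcases mem_sup_span_singleton hu with hu | ⟨t, ht, rfl⟩
    · exact hUB u hu hu0
    · exact fun hb => hxu (-t) (neg_mem ht) _ hb (by abel)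

end Ramsey

/-! ### Coset averages and the energy-increment regularity lemma. -/

section Averaging

open Module Submodule Finset
open scoped Classical

variable {n : ℕ} {W W' : Submodule (ZMod 2) (Fin n → ZMod 2)} {f g : (Fin n → ZMod 2) → ℝ}
  {x w r : Fin n → ZMod 2} {ε : ℝ}

/-- The average of `f` over the coset `x + W`. -/
noncomputable def avg (W : Submodule (ZMod 2) (Fin n → ZMod 2)) (f : (Fin n → ZMod 2) → ℝ)
    (x : Fin n → ZMod 2) : ℝ :=
  (Fintype.card W : ℝ)⁻¹ * ∑ w : W, f (x + w)

theorem card_submodule_pos (W : Submodule (ZMod 2) (Fin n → ZMod 2)) :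
    0 < (Fintype.card W : ℝ) := by
  exact_mod_cast Fintype.card_pos

theorem avg_add_mem (hw : w ∈ W) : avg W f (x + w) = avg W f x := by
  unfold avg
  congr 1
  exact Fintype.sum_equiv (Equiv.addLeft ⟨w, hw⟩) _ _ fun v => by simp [add_assoc]

theorem avg_congr (h : ∀ w ∈ W, f (x + w) = g (x + w)) : avg W f x = avg W g x := by
  unfold avg
  congr 1
  exact Fintype.sum_congr _ _ fun w => h w w.2

theorem avg_le_avg (h : ∀ y, f y ≤ g y) : avg W f x ≤ avg W g x := by
  have := card_submodule_pos W
  unfold avg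
  gcongr
  exact h _

theorem avg_const (c : ℝ) : avg W (fun _ => c) x = c := by
  have := card_submodule_pos W
  simp only [avg, sum_const, card_univ, nsmul_eq_mul]
  field_simp

theorem avg_sub : avg W (fun y => f y - g y) x = avg W f x - avg W g x := by
  simp [avg, mul_sub]

theorem avg_mul_left (h : ∀ w ∈ W, g (x + w) = g x) :
    avg W (fun y => g y * f y) x = g x * avg W f x := by
  simp only [avg, mul_sum]
  refine Fintype.sum_congr _ _ fun w => ?_
  rw [h w w.2]
  ring

theorem sum_avg : ∑ x, avg W f x = ∑ x, f x := by
  have := card_submodule_pos W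
  have h : ∀ w : W, ∑ x, f (x + w) = ∑ x, f x := fun w =>
    Fintype.sum_equiv (Equiv.addRight (w : Fin n → ZMod 2)) _ _ fun _ => rfl
  simp only [avg, ← mul_sum]
  rw [sum_comm]
  simp only [h, sum_const, card_univ, nsmul_eq_mul]
  field_simp

theorem avg_avg (hW : W' ≤ W) : avg W (avg W' f) x = avg W f x := by
  have := card_submodule_pos W'
  have h : ∀ v : W', ∑ w : W, f (x + w + v) = ∑ w : W, f (x + w) := fun v =>
    Fintype.sum_equiv (Equiv.addRight (⟨v, hW v.2⟩ : W)) _ _ fun w => by simp [add_assoc]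
  unfold avg
  rw [← mul_sum, sum_comm]
  simp only [h, sum_const, card_univ, nsmul_eq_mul]
  field_simp

theorem sq_avg_le : avg W f x ^ 2 ≤ avg W (fun y => f y ^ 2) x := by
  have := card_submodule_pos W
  have h := sq_sum_le_card_mul_sum_sq (s := (univ : Finset W)) (f := fun w => f (x + w))
  rw [card_univ] at h
  unfold avg
  rw [mul_pow, pow_two (Fintype.card W : ℝ)⁻¹, mul_assoc]
  gcongr
  rwa [inv_mul_le_iff₀ this]

/-- Passing to a smaller subspace increases the energy `∑ (avg W f) ^ 2` by the squared distance
between the averages. -/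
theorem sum_sq_avg_sub (hW : W' ≤ W) :
    ∑ x, (avg W' f x - avg W f x) ^ 2 = ∑ x, avg W' f x ^ 2 - ∑ x, avg W f x ^ 2 := by
  -- `avg W` acts as an orthogonal projection, so the identity is Pythagoras.
  have h : ∑ x, avg W f x * avg W' f x = ∑ x, avg W f x ^ 2 := by
    rw [← sum_avg (W := W)]
    refine Fintype.sum_congr _ _ fun x => ?_
    rw [avg_mul_left fun w hw => avg_add_mem hw, avg_avg hW, pow_two]
  have h2 : ∑ x, (avg W' f x - avg W f x) ^ 2 =
      ∑ x, avg W' f x ^ 2 - 2 * ∑ x, avg W f x * avg W' f x + ∑ x, avg W f x ^ 2 := by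
    rw [mul_sum, ← sum_sub_distrib, ← sum_add_distrib]
    exact Fintype.sum_congr _ _ fun x => by ring
  rw [h2, h]
  ring

/-- The nontrivial real character of `ZMod 2`. -/
noncomputable def sgn (t : ZMod 2) : ℝ := if t = 0 then 1 else -1

theorem eq_zero_or_one_of_zmod_two : ∀ t : ZMod 2, t = 0 ∨ t = 1 := by decide

theorem sgn_zero : sgn 0 = 1 := by simp [sgn]

theorem sgn_one : sgn 1 = -1 := by simp [sgn]

theorem sgn_add (s t : ZMod 2) : sgn (s + t) = sgn s * sgn t := by
  have h : (1 + 1 : ZMod 2) = 0 := by decide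
  rcases eq_zero_or_one_of_zmod_two s with rfl | rfl <;>
    rcases eq_zero_or_one_of_zmod_two t with rfl | rfl <;>
    simp [h, sgn_zero, sgn_one]

theorem abs_sgn (t : ZMod 2) : |sgn t| = 1 := by
  rcases eq_zero_or_one_of_zmod_two t with rfl | rfl <;> simp [sgn_zero, sgn_one]

theorem sgn_sq (t : ZMod 2) : sgn t ^ 2 = 1 := by
  rw [← sq_abs, abs_sgn, one_pow]

theorem avg_sgn (hr : r ∉ perp W) : avg W (fun y => sgn (r ⬝ᵥ y)) x = 0 := by
  have hr' : ∃ v ∈ W, r ⬝ᵥ v ≠ 0 := by simpa [perp] using hr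
  obtain ⟨v, hv, hrv⟩ := hr'
  have h1 : r ⬝ᵥ v = 1 := (eq_zero_or_one_of_zmod_two _).resolve_left hrv
  have h := avg_add_mem (f := fun y => sgn (r ⬝ᵥ y)) (x := x) hv
  have h2 : avg W (fun y => sgn (r ⬝ᵥ y)) (x + v) = -avg W (fun y => sgn (r ⬝ᵥ y)) x := by
    unfold avg
    rw [← mul_neg, ← sum_neg_distrib]
    congr 1
    refine Fintype.sum_congr _ _ fun w => ?_
    simp [dotProduct_add, sgn_add, h1, sgn_one]
  linarith

/-- The twist of `f` by the character with frequency `r`. -/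
noncomputable def twist (r : Fin n → ZMod 2) (f : (Fin n → ZMod 2) → ℝ) (y : Fin n → ZMod 2) : ℝ :=
  sgn (r ⬝ᵥ y) * f y

/-- A large Fourier coefficient on `x + W` at a frequency `r` orthogonal to `W' ≤ W` forces the
averages on `W'` to deviate from those on `W`. -/
theorem sq_avg_twist_le (hW : W' ≤ W) (hr : r ∉ perp W) (hr' : r ∈ perp W') :
    avg W (twist r f) x ^ 2 ≤ avg W (fun y => (avg W' f y - avg W f y) ^ 2) x := by
  -- The character is constant on cosets of `W'`, so `f` may be averaged over them; it has mean zero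
  -- on `x + W`, so the constant `avg W f` may be subtracted. Cauchy–Schwarz finishes.
  have h1 : avg W (twist r f) x = avg W (twist r (avg W' f)) x := by
    rw [← avg_avg hW]
    refine avg_congr fun w _ => ?_
    exact avg_mul_left fun v hv => by rw [dotProduct_add, hr' v hv, add_zero]
  have h2 : avg W (twist r (avg W f)) x = 0 := by
    have : avg W (twist r (avg W f)) x = avg W (fun y => avg W f y * sgn (r ⬝ᵥ y)) x :=
      avg_congr fun w _ => mul_comm _ _
    rw [this, avg_mul_left fun w hw => avg_add_mem hw, avg_sgn hr, mul_zero]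
  have h3 : avg W (twist r f) x = avg W (twist r fun y => avg W' f y - avg W f y) x := by
    rw [h1, ← sub_zero (avg W (twist r (avg W' f)) x), ← h2, ← avg_sub]
    exact avg_congr fun w _ => by simp only [twist]; ring
  rw [h3]
  refine sq_avg_le.trans_eq (avg_congr fun w _ => ?_)
  rw [twist, mul_pow, sgn_sq, one_mul]

/-- The points `x` for which `f` has a large nontrivial Fourier coefficient on `x + W`. -/
noncomputable def badSet (ε : ℝ) (f : (Fin n → ZMod 2) → ℝ)
    (W : Submodule (ZMod 2) (Fin n → ZMod 2)) : Finset (Fin n → ZMod 2) :=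
  {x | ∃ r, r ∉ perp W ∧ ε < |avg W (twist r f) x|}

/-- Intersecting `W` with the kernels of one witnessing frequency per bad coset costs at most one
dimension per coset, and `sq_avg_twist_le` yields an energy gain of `ε ^ 2` per bad point. -/
theorem exists_refinement (hε : 0 < ε) (f : (Fin n → ZMod 2) → ℝ)
    (W : Submodule (ZMod 2) (Fin n → ZMod 2)) :
    ∃ W' ≤ W,
      finrank (ZMod 2) ((Fin n → ZMod 2) ⧸ W') ≤
        finrank (ZMod 2) ((Fin n → ZMod 2) ⧸ W) + 2 ^ finrank (ZMod 2) ((Fin n → ZMod 2) ⧸ W) ∧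
      ∑ x, avg W f x ^ 2 + #(badSet ε f W) * ε ^ 2 ≤ ∑ x, avg W' f x ^ 2 := by
  have hex : ∀ q : (Fin n → ZMod 2) ⧸ W, ∃ r, q.out ∈ badSet ε f W →
      r ∉ perp W ∧ ε < |avg W (twist r f) q.out| := by
    intro q
    by_cases hq : q.out ∈ badSet ε f W
    · obtain ⟨r, hr⟩ := (mem_filter.1 hq).2
      exact ⟨r, fun _ => hr⟩
    · exact ⟨0, fun h => absurd h hq⟩
  choose r hr using hex
  let T : (Fin n → ZMod 2) →ₗ[ZMod 2]
      ((Fin n → ZMod 2) ⧸ W) × ((Fin n → ZMod 2) ⧸ W → ZMod 2) :=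
    W.mkQ.prod (LinearMap.pi fun q => dotProductBilin (ZMod 2) (ZMod 2) (r q))
  have hTW : LinearMap.ker T ≤ W := fun v hv => by
    have : T v = 0 := hv
    have := congrArg Prod.fst this
    simpa [T] using this
  have hTr : ∀ q, r q ∈ perp (LinearMap.ker T) := fun q v hv => by
    have : T v = 0 := hv
    have := congrFun (congrArg Prod.snd this) q
    simpa [T] using this
  refine ⟨LinearMap.ker T, hTW, ?_, ?_⟩
  · rw [T.quotKerEquivRange.finrank_eq]
    refine (Submodule.finrank_le _).trans_eq ?_
    rw [finrank_prod, finrank_pi, Module.card_eq_pow_finrank (K := ZMod 2), ZMod.card]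
  · have key : #(badSet ε f W) * ε ^ 2 ≤
        ∑ x, (avg (LinearMap.ker T) f x - avg W f x) ^ 2 := by
      rw [← sum_avg (W := W), ← nsmul_eq_mul, ← sum_const]
      refine (sum_le_sum fun x hx => ?_).trans
        (sum_le_sum_of_subset_of_nonneg (subset_univ _) fun x _ _ => ?_)
      · set q : (Fin n → ZMod 2) ⧸ W := Submodule.Quotient.mk x with hq
        have hmem : q.out - x ∈ W := by
          rw [← Submodule.Quotient.eq, hq]
          exact Quotient.out_eq' _
        have hinv : ∀ h : (Fin n → ZMod 2) → ℝ, avg W h q.out = avg W h x := fun h => by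
          rw [← avg_add_mem (x := x) hmem]
          congr 1
          abel
        have hqb : q.out ∈ badSet ε f W := by
          simpa only [badSet, mem_filter, mem_univ, true_and, hinv] using hx
        obtain ⟨h1, h2⟩ := hr q hqb
        rw [hinv] at h2
        refine le_trans ?_ (sq_avg_twist_le hTW h1 (hTr q))
        rw [← sq_abs (avg W _ x)]
        gcongr
      · exact (avg_const (W := W) (x := x) 0).symm.le.trans (avg_le_avg fun y => sq_nonneg _)
    rw [sum_sq_avg_sub hTW] at key
    linarith

/-- Arithmetic regularity lemma: below any subspace `W₀` of codimension at most `m` there is a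
subspace `W` of bounded codimension such that `f` is uniform on almost all cosets of `W`. -/
theorem exists_regular_subspace {δ : ℝ} (hε : 0 < ε) (hδ : 0 < δ) (m : ℕ) :
    ∃ C : ℕ, ∀ (n : ℕ) (f : (Fin n → ZMod 2) → ℝ), (∀ x, |f x| ≤ 1) →
      ∀ W₀ : Submodule (ZMod 2) (Fin n → ZMod 2),
        finrank (ZMod 2) ((Fin n → ZMod 2) ⧸ W₀) ≤ m →
        ∃ W ≤ W₀, finrank (ZMod 2) ((Fin n → ZMod 2) ⧸ W) ≤ C ∧
          (#(badSet ε f W) : ℝ) ≤ δ * 2 ^ n := by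
  have step : ∀ k : ℕ, ∃ C : ℕ, ∀ (n : ℕ) (f : (Fin n → ZMod 2) → ℝ),
      ∀ W₀ : Submodule (ZMod 2) (Fin n → ZMod 2),
        finrank (ZMod 2) ((Fin n → ZMod 2) ⧸ W₀) ≤ m →
        ∃ W ≤ W₀, finrank (ZMod 2) ((Fin n → ZMod 2) ⧸ W) ≤ C ∧
          ((#(badSet ε f W) : ℝ) ≤ δ * 2 ^ n ∨
            k * (δ * ε ^ 2 * 2 ^ n) ≤ ∑ x, avg W f x ^ 2) := by
    intro k
    induction k with
    | zero =>
      refine ⟨m, fun n f W₀ h => ⟨W₀, le_rfl, h, Or.inr ?_⟩⟩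
      rw [Nat.cast_zero, zero_mul]
      exact sum_nonneg fun x _ => sq_nonneg _
    | succ k ih =>
      obtain ⟨C, hC⟩ := ih
      refine ⟨C + 2 ^ C, fun n f W₀ h => ?_⟩
      obtain ⟨W, hW, hWC, hgood | henergy⟩ := hC n f W₀ h
      · exact ⟨W, hW, hWC.trans (Nat.le_add_right _ _), Or.inl hgood⟩
      by_cases hbad : (#(badSet ε f W) : ℝ) ≤ δ * 2 ^ n
      · exact ⟨W, hW, hWC.trans (Nat.le_add_right _ _), Or.inl hbad⟩
      obtain ⟨W', hW', hc, he⟩ := exists_refinement hε f W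
      refine ⟨W', hW'.trans hW, hc.trans (by gcongr; norm_num), Or.inr ?_⟩
      have : δ * 2 ^ n * ε ^ 2 ≤ #(badSet ε f W) * ε ^ 2 := by
        gcongr
        exact (not_le.1 hbad).le
      push_cast
      linarith
  -- The energy never exceeds `2 ^ n`, so fewer than `k` increments are possible.
  obtain ⟨k, hk⟩ := exists_nat_gt (1 / (δ * ε ^ 2))
  obtain ⟨C, hC⟩ := step k
  refine ⟨C, fun n f hf W₀ h => ?_⟩
  obtain ⟨W, hW, hWC, hgood | henergy⟩ := hC n f W₀ h
  · exact ⟨W, hW, hWC, hgood⟩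
  exfalso
  have hle : ∑ x, avg W f x ^ 2 ≤ 2 ^ n := by
    calc ∑ x, avg W f x ^ 2 ≤ ∑ x : Fin n → ZMod 2, 1 := sum_le_sum fun x _ =>
          sq_avg_le.trans ((avg_le_avg fun y => (sq_le_one_iff_abs_le_one _).2 (hf y)).trans_eq
            (avg_const 1))
      _ = 2 ^ n := by simp
  rw [div_lt_iff₀ (by positivity)] at hk
  have : (1 : ℝ) * 2 ^ n < k * (δ * ε ^ 2) * 2 ^ n := by gcongr
  linarith

end Averaging

/-! ### Combining regularity and Ramsey. -/

section Main

open Module Submodule Finset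
open scoped Classical

variable {n : ℕ} {V W S : Submodule (ZMod 2) (Fin n → ZMod 2)} {f h : (Fin n → ZMod 2) → ℝ}
  {x r : Fin n → ZMod 2}

theorem avg_sup : avg (W ⊔ S) f x = avg S (avg W f) x := by
  have hinv : ∀ v ∈ W ⊔ S, avg S (avg W f) (x + v) = avg S (avg W f) x := by
    intro v hv
    obtain ⟨w, hw, s, hs, rfl⟩ := Submodule.mem_sup.1 hv
    rw [← add_assoc, avg_add_mem hs]
    unfold avg
    congr 1
    refine Fintype.sum_congr _ _ fun u => ?_
    have := avg_add_mem (f := f) (x := x + u) hw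
    rwa [add_right_comm] at this
  calc avg (W ⊔ S) f x = avg (W ⊔ S) (avg S (avg W f)) x := by
        rw [avg_avg le_sup_right, avg_avg le_sup_left]
    _ = avg (W ⊔ S) (fun _ => avg S (avg W f) x) x := avg_congr hinv
    _ = _ := avg_const _

theorem abs_avg_le {c : ℝ} (hf : ∀ y, |f y| ≤ c) : |avg W f x| ≤ c := by
  rw [abs_le]
  constructor
  · calc -c = avg W (fun _ => -c) x := (avg_const _).symm
      _ ≤ _ := avg_le_avg fun y => (abs_le.1 (hf y)).1
  · calc avg W f x ≤ avg W (fun _ => c) x := avg_le_avg fun y => (abs_le.1 (hf y)).2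
      _ = c := avg_const _

/-- Nothing is known at the zero vector beyond the trivial bound, which costs `1/|S|`. -/
theorem abs_avg_zero_le {η : ℝ} (hη : 0 ≤ η) (h0 : |h 0| ≤ 1)
    (hS : ∀ s ∈ S, s ≠ 0 → |h s| ≤ η) :
    |avg S h 0| ≤ η + (Fintype.card S : ℝ)⁻¹ := by
  have hc := card_submodule_pos S
  have key : ∑ s : S, |h (0 + s)| ≤ Fintype.card S * η + 1 := by
    calc ∑ s : S, |h (0 + s)| ≤ ∑ s : S, (η + if s = 0 then 1 else 0) := by
          refine sum_le_sum fun s _ => ?_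
          by_cases hs : s = 0
          · subst hs
            simp only [ZeroMemClass.coe_zero, add_zero, if_true]
            linarith
          · simpa [hs] using hS s s.2 (by simpa using hs)
      _ = Fintype.card S * η + 1 := by simp [sum_add_distrib]
  calc |avg S h 0| ≤ (Fintype.card S : ℝ)⁻¹ * ∑ s : S, |h (0 + s)| := by
        rw [avg, abs_mul, abs_of_pos (inv_pos.2 hc)]
        gcongr
        exact abs_sum_le_sum_abs _ _
    _ ≤ (Fintype.card S : ℝ)⁻¹ * (Fintype.card S * η + 1) := by gcongr
    _ = η + (Fintype.card S : ℝ)⁻¹ := by field_simp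

/-- If `f` is uniform on the cosets `s + W`, `0 ≠ s ∈ S`, and has nearly the same density on each
of them, then its nontrivial Fourier coefficients on `W ⊔ S` are small. -/
theorem abs_avg_sup_twist_le {η a : ℝ} (hη : 0 ≤ η) (hf : ∀ y, f y ∈ Set.Icc (0 : ℝ) 1)
    (ha : a ∈ Set.Icc (0 : ℝ) 1) (hbad : ∀ s ∈ S, s ≠ 0 → s ∉ badSet η f W)
    (hdens : ∀ s ∈ S, s ≠ 0 → |avg W f s - a| ≤ η) (hr : r ∉ perp (W ⊔ S)) :
    |avg (W ⊔ S) (twist r f) 0| ≤ η + (Fintype.card S : ℝ)⁻¹ := by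
  rw [avg_sup]
  by_cases hrW : r ∈ perp W
  · have hrS : r ∉ perp S := fun hrS => hr fun v hv => by
      obtain ⟨w, hw, s, hs, rfl⟩ := Submodule.mem_sup.1 hv
      rw [dotProduct_add, hrW w hw, hrS s hs, add_zero]
    have htw : ∀ y, avg W (twist r f) y = sgn (r ⬝ᵥ y) * avg W f y := fun y =>
      avg_mul_left fun w hw => by rw [dotProduct_add, hrW w hw, add_zero]
    have hsub : avg S (avg W (twist r f)) 0 = avg S (twist r fun y => avg W f y - a) 0 := by
      have h0 : avg S (fun y => a * sgn (r ⬝ᵥ y)) 0 = 0 := by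
        rw [avg_mul_left (g := fun _ => a) fun _ _ => rfl, avg_sgn hrS, mul_zero]
      rw [← sub_zero (avg S (avg W _) 0), ← h0, ← avg_sub]
      refine avg_congr fun s _ => ?_
      rw [htw, twist]
      ring
    have habs : ∀ y, |twist r (fun y => avg W f y - a) y| = |avg W f y - a| := fun y => by
      rw [twist, abs_mul, abs_sgn, one_mul]
    rw [hsub]
    refine abs_avg_zero_le hη ?_ fun s hs hs0 => ?_
    · rw [habs, abs_le]
      have h1 : avg W f 0 ≤ 1 := (avg_le_avg fun y => (hf y).2).trans_eq (avg_const 1)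
      have h0 : 0 ≤ avg W f 0 := (avg_const 0).symm.trans_le (avg_le_avg fun y => (hf y).1)
      constructor <;> linarith [ha.1, ha.2]
    · rw [habs]
      exact hdens s hs hs0
  · refine abs_avg_zero_le hη (abs_avg_le fun y => ?_) fun s hs hs0 => ?_
    · rw [twist, abs_mul, abs_sgn, one_mul, abs_of_nonneg (hf y).1]
      exact (hf y).2
    · by_contra hlt
      exact hbad s hs hs0 (mem_filter.2 ⟨mem_univ _, r, hrW, not_le.1 hlt⟩)

theorem stdAddChar_neg_eq_sgn (t : ZMod 2) : ZMod.stdAddChar (-t) = (sgn t : ℂ) := by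
  rcases eq_zero_or_one_of_zmod_two t with rfl | rfl
  · simp [sgn_zero]
  · have h1 : (-1 : ZMod 2) = ((1 : ℤ) : ZMod 2) := by decide
    rw [h1, ZMod.stdAddChar_coe, sgn_one]
    have h2 : (2 * Real.pi * Complex.I * (1 : ℤ) / (2 : ℕ) : ℂ) = Real.pi * Complex.I := by
      push_cast
      ring
    rw [h2, Complex.exp_pi_mul_I]
    simp

theorem fourierCoeffAt_eq_avg (A : Set (Fin n → ZMod 2)) (V : Submodule (ZMod 2) (Fin n → ZMod 2))
    (r : Fin n → ZMod 2) :
    fourierCoeffAt (fun y => A.indicator 1 y * unif (coset 0 V) y) r =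
      (avg V (twist r (A.indicator 1)) 0 : ℝ) := by
  have hcoset : coset 0 V = V := by simp [coset]
  have hsum : ∀ g : (Fin n → ZMod 2) → ℂ, ∑ v : V, g v = ∑ x, if x ∈ V then g x else 0 :=
    fun g => by
      rw [← sum_filter]
      exact (sum_subtype _ (by simp) g).symm
  unfold fourierCoeffAt avg
  rw [hcoset]
  push_cast
  simp only [zero_add]
  rw [hsum fun v => (twist r (A.indicator 1) v : ℂ), mul_sum]
  refine Fintype.sum_congr _ _ fun x => ?_
  rw [stdAddChar_neg_eq_sgn]
  by_cases hV : x ∈ V <;> by_cases hA : x ∈ A <;>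
    simp [unif, twist, hV, hA, Nat.card_eq_fintype_card]

theorem card_filter_mem (W : Submodule (ZMod 2) (Fin n → ZMod 2)) :
    #({x | x ∈ W} : Finset (Fin n → ZMod 2)) = 2 ^ finrank (ZMod 2) W := by
  rw [← Fintype.card_subtype]
  simpa using Module.card_eq_pow_finrank (K := ZMod 2) (V := W)

theorem exists_subspace_finrank_quotient_eq {m : ℕ} (hm : m ≤ n) :
    ∃ W : Submodule (ZMod 2) (Fin n → ZMod 2), finrank (ZMod 2) ((Fin n → ZMod 2) ⧸ W) = m := by
  have hle : n - m ≤ finrank (ZMod 2) (Fin n → ZMod 2) := by simp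
  obtain ⟨v, hv⟩ := exists_linearIndependent_of_le_finrank hle
  refine ⟨span (ZMod 2) (Set.range v), ?_⟩
  have h1 := finrank_span_eq_card hv
  have h2 := (span (ZMod 2) (Set.range v)).finrank_quotient_add_finrank
  simp only [Fintype.card_fin, finrank_fin_fun] at h1 h2
  omega

/-- In large dimension there is a subspace `W` of bounded codimension and a subspace `U` of
prescribed dimension such that `f` is uniform on `u + W` for all nonzero `u ∈ U`. -/
theorem exists_uniform_cosets {η : ℝ} (hη : 0 < η) (D : ℕ) :
    ∃ C : ℕ, ∀ n, D + 2 ≤ n → ∀ f : (Fin n → ZMod 2) → ℝ, (∀ x, |f x| ≤ 1) →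
      ∃ W U : Submodule (ZMod 2) (Fin n → ZMod 2),
        finrank (ZMod 2) ((Fin n → ZMod 2) ⧸ W) ≤ C ∧ finrank (ZMod 2) U = D ∧
          ∀ u ∈ U, u ≠ 0 → u ∉ badSet η f W := by
  -- The bad set and `W` each have density at most `2 ^ (-(D + 2))`, so `2 ^ D` times their union is
  -- at most half the space.
  obtain ⟨C, hC⟩ := exists_regular_subspace (δ := (2 ^ (D + 2))⁻¹) hη (by positivity) (D + 2)
  refine ⟨C, fun n hn f hf => ?_⟩
  obtain ⟨W₀, hW₀⟩ := exists_subspace_finrank_quotient_eq hn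
  obtain ⟨W, hW, hWC, hbad⟩ := hC n f hf W₀ hW₀.le
  have hrank : D + 2 + finrank (ZMod 2) W ≤ n := by
    have h1 := W₀.finrank_quotient_add_finrank
    have h2 := finrank_mono (R := ZMod 2) hW
    simp only [finrank_fin_fun] at h1
    omega
  have hbad' : 2 ^ (D + 2) * #(badSet η f W) ≤ 2 ^ n := by
    rw [← div_eq_inv_mul, le_div_iff₀ (by positivity)] at hbad
    rw [mul_comm]
    exact_mod_cast hbad
  have hW' : 2 ^ (D + 2) * 2 ^ finrank (ZMod 2) W ≤ 2 ^ n := by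
    rw [← pow_add]
    exact Nat.pow_le_pow_right (by norm_num) hrank
  -- Including `W` puts `0` in the avoided set.
  obtain ⟨U, hU, hUB⟩ := exists_subspace_avoiding (D := D)
    (badSet η f W ∪ ({x | x ∈ W} : Finset (Fin n → ZMod 2))) (by simp) (by
      have h1 := card_union_le (badSet η f W) ({x | x ∈ W} : Finset (Fin n → ZMod 2))
      rw [card_filter_mem] at h1
      have h2 := Nat.mul_le_mul_left (2 ^ D) h1
      have h3 : 0 < 2 ^ n := by positivity
      rw [pow_add] at hbad' hW'
      refine h2.trans_lt ?_
      nlinarith)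
  exact ⟨W, U, hWC, hU, fun u hu hu0 hub => hUB u hu hu0 (mem_union_left _ hub)⟩

theorem exists_isUniformOn (ε : ℝ) (hε : 0 < ε) :
    ∃ C : ℕ, ∀ (n : ℕ) (A : Set (Fin n → ZMod 2)),
      ∃ V : Submodule (ZMod 2) (Fin n → ZMod 2),
        finrank (ZMod 2) ((Fin n → ZMod 2) ⧸ V) ≤ C ∧ IsUniformOn ε A 0 V := by
  -- The same `k` sets the density mesh `1/k` and `dim S`; both `1/k` and `2 ^ (-k)` are at most `ε
  -- / 2`.
  obtain ⟨k, hk⟩ := exists_nat_gt (2 / ε)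
  have hk0 : (0 : ℝ) < k := (by positivity : (0 : ℝ) < 2 / ε).trans hk
  have hkε : (k : ℝ)⁻¹ ≤ ε / 2 := by
    rw [← inv_div]
    exact inv_anti₀ (by positivity) hk.le
  obtain ⟨D, hD⟩ := exists_mono_subspace (Fin (k + 1)) fun _ => k
  obtain ⟨C, hC⟩ := exists_uniform_cosets (half_pos hε) D
  refine ⟨C + (D + 2), fun n A => ?_⟩
  by_cases hn : n ≤ D + 2
  -- For small `n` the zero subspace works: no frequency lies outside its complement.
  · refine ⟨⊥, (Submodule.finrank_quotient_le _).trans (by simp; omega), fun r hr => ?_⟩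
    exact absurd (fun v hv => by rw [(Submodule.mem_bot _).1 hv, dotProduct_zero]) hr
  set f : (Fin n → ZMod 2) → ℝ := A.indicator 1 with hfdef
  have hf : ∀ y, f y ∈ Set.Icc (0 : ℝ) 1 := fun y => by
    by_cases hy : y ∈ A <;> simp [hfdef, hy]
  obtain ⟨W, U, hWC, hU, hUW⟩ := hC n (by omega) f fun y => by
    rw [abs_of_nonneg (hf y).1]
    exact (hf y).2
  have havg0 : ∀ x, 0 ≤ avg W f x := fun x =>
    (avg_const 0).symm.trans_le (avg_le_avg fun y => (hf y).1)
  have havg1 : ∀ x, avg W f x ≤ 1 := fun x =>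
    (avg_le_avg fun y => (hf y).2).trans_eq (avg_const 1)
  obtain ⟨κ, S, hSU, hS, hκ⟩ := hD n U hU.ge fun x =>
    ⟨⌊k * avg W f x⌋₊, Nat.lt_succ_of_le (Nat.floor_le_of_le (by nlinarith [havg1 x]))⟩
  refine ⟨W ⊔ S, ?_, fun r hr => ?_⟩
  · have h1 := W.finrank_quotient_add_finrank
    have h2 := (W ⊔ S).finrank_quotient_add_finrank
    have h3 := finrank_mono (R := ZMod 2) (le_sup_left : W ≤ W ⊔ S)
    omega
  · rw [fourierCoeffAt_eq_avg, Complex.norm_real, Real.norm_eq_abs]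
    have hκk : ((κ : ℕ) : ℝ) ≤ k := by exact_mod_cast Nat.lt_succ_iff.1 κ.2
    refine (abs_avg_sup_twist_le (a := (κ : ℕ) / k) (half_pos hε).le hf
      ⟨by positivity, (div_le_one hk0).2 hκk⟩ (fun s hs => hUW s (hSU hs))
      (fun s hs hs0 => ?_) hr).trans ?_
    · have hfl : ⌊k * avg W f s⌋₊ = (κ : ℕ) := congrArg Fin.val (hκ s hs hs0)
      have h1 := Nat.floor_le (mul_nonneg hk0.le (havg0 s))
      have h2 := Nat.lt_floor_add_one (k * avg W f s)
      rw [hfl] at h1 h2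
      have h3 : avg W f s - (κ : ℕ) / k = (k * avg W f s - (κ : ℕ)) * (k : ℝ)⁻¹ := by
        field_simp
      rw [h3, abs_of_nonneg (mul_nonneg (by linarith) (by positivity))]
      refine le_trans ?_ hkε
      exact mul_le_of_le_one_left (by positivity) (by linarith)
    · have hcard : Fintype.card S = 2 ^ k := by
        rw [Module.card_eq_pow_finrank (K := ZMod 2), ZMod.card, hS]
      have : (Fintype.card S : ℝ)⁻¹ ≤ (k : ℝ)⁻¹ := by
        refine inv_anti₀ hk0 ?_
        rw [hcard]
        exact_mod_cast Nat.lt_two_pow_self.le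
      linarith

end Main

end FourierUniformity

theorem theorem2 (ε : ℝ) (hε : 0 < ε) :
    ∃ C : ℕ, ∀ (n : ℕ) (A : Set (Fin n → ZMod 2)),
      ∃ V : Submodule (ZMod 2) (Fin n → ZMod 2),
        Module.finrank (ZMod 2) ((Fin n → ZMod 2) ⧸ V) ≤ C ∧
          FourierUniformity.IsUniformOn ε A 0 V := by
  exact FourierUniformity.exists_isUniformOn ε hε
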